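/- Let $\Sigma=\mathbb N\cup\{\#\}$ be the input alphabet and $\Omega=\mathbb N\cup\{?\}$ the output alphabet. Let $\varphi$ be the standard acceptable numbering of the partial computable functions $\mathbb N\rightharpoonup\mathbb N$ and $W_p=\mathrm{dom}(\varphi_p)$; the symbol $?$ is an index of no set, so every condition below of the form "$W_h=\dots$" or "$\dots\subseteq W_h$" includes $h\neq{?}$. A language is a computably enumerable set $L\subseteq\mathbb N$. For a finite or infinite sequence $f$ over $\Sigma$ let $\mathrm{content}(f)=\mathrm{ran}(f)\setminus\{\#\}$; a text for $L$ is a $T\in\Sigma^{\mathbb N}$ with $\mathrm{content}(T)=L$, and $T[t]$ is its initial segment of length $t$. An iterative learner is a partial function $M:\Sigma^{<\omega}\rightharpoonup\Omega$ given by a partial computable $h:\Omega\times\Sigma\rightharpoonup\Omega$ through $M(\epsilon)={?}$ and $M(\sigma x)=h(M(\sigma),x)$. A bounded memory states (BMS) learner is a partial function $M:\Sigma^{<\omega}\rightharpoonup\Omega$ given by partial computable $h:\mathbb N\times\Sigma\rightharpoonup\Omega$ and $s:\mathbb N\times\Sigma\rightharpoonup\mathbb N$ with $\mathrm{dom}(h)=\mathrm{dom}(s)$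 through $s^*(\epsilon)=0$, $s^*(\sigma x)=s(s^*(\sigma),x)$, $M(\epsilon)={?}$ and $M(\sigma x)=h(s^*(\sigma),x)$; it uses finitely many states on $T$ if $\{s^*(T[t]) : t\in\mathbb N\}$ is finite. Suppose that $h_t:=M(T[t])$ is defined for all $t$. Then $M$ on $T$ is - $\mathbf{Ex}$-successful if there is $t_0$ with $W_{h_{t_0}}=\mathrm{content}(T)$ such that $h_t=h_{t_0}$ for all $t\ge t_0$ with $h_t\neq{?}$; - strongly non-U-shaped ($\mathbf{SNU}$) if for all $r\le s\le t$: $W_{h_r}=W_{h_t}=\mathrm{content}(T)$ implies $h_r=h_s$; - strongly decisive ($\mathbf{SDec}$) if for all $r\le s\le t$: $W_{h_r}=W_{h_t}$ implies $h_r=h_s$; - conservative ($\mathbf{Conv}$) if for all $s\le t$: $\mathrm{content}(T[t])\subseteq W_{h_s}$ implies $h_s=h_t$. For $\delta\in\{\mathbf{SNU},\mathbf{SDec},\mathbf{Conv}\}$ let $[\mathbf{It}\,\mathbf{Txt}\,\delta\,\mathbf{Ex}]$ be the set of all collections $\mathcal L$ of languages for which there is one iterative learner $M$ such that, for every $L\in\mathcal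 L$ and every text $T$ for $L$, $M(T[t])$ is defined for all $t$, and $M$ satisfies $\delta$ and is $\mathbf{Ex}$-successful on $T$. Let $[\mathbf{Txt}\,\mathbf{BMS}_*\,\delta\,\mathbf{Ex}]$ be defined in the same way with one BMS learner that, moreover, uses finitely many states on every such $T$. Theorem. For each $\delta\in\{\mathbf{SNU},\mathbf{SDec},\mathbf{Conv}\}$, $$[\mathbf{It}\,\mathbf{Txt}\,\delta\,\mathbf{Ex}]\subsetneq[\mathbf{Txt}\,\mathbf{BMS}_*\,\delta\,\mathbf{Ex}].$$ -/

import Mathlib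

namespace InductiveInference

/-- Input alphabet `ℕ ∪ {#}`; `none` is the pause symbol `#`. -/
abbrev Datum : Type := Option ℕ

/-- Output alphabet `ℕ ∪ {?}`; `none` is the symbol `?`. -/
abbrev Hyp : Type := Option ℕ

/-- The partial computable function with program code `p`, in the standard acceptable
programming system given by the codes for partial recursive functions. -/
def phi (p : ℕ) : ℕ →. ℕ := (Denumerable.ofNat Nat.Partrec.Code p).eval

/-- The computably enumerable set with index `p`. -/
def W (p : ℕ) : Set ℕ := {x | (phi p x).Dom}

/-- A language is a computably enumerable set of natural numbers. -/
def IsLanguage (L : Set ℕ) : Prop := REPred fun n => n ∈ L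

/-- The initial segment `T[t]` of length `t`. -/
def initSeg (T : ℕ → Datum) (t : ℕ) : List Datum := (List.range t).map T

/-- The content of a finite sequence. -/
def listContent (σ : List Datum) : Set ℕ := {n | some n ∈ σ}

/-- The content of an infinite sequence. -/
def content (T : ℕ → Datum) : Set ℕ := {n | ∃ t, T t = some n}

/-- `T` is a text for `L`. -/
def IsText (T : ℕ → Datum) (L : Set ℕ) : Prop := content T = L

/-- The hypothesis `h` is an index (so not `?`) of the set `A`. -/
def IsIndexOf (h : Hyp) (A : Set ℕ) : Prop := ∃ p, h = some p ∧ W p = A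

/-! ### Iterative learners -/

/-- The learner generated by `h`: the empty sequence is mapped to `?`, and
`σ ⌢ x` to `h (value at σ) x`. -/
def itLearner (h : Hyp → Datum →. Hyp) (σ : List Datum) : Part Hyp :=
  σ.foldl (fun e x => e.bind fun e' => h e' x) (Part.some none)

theorem itLearner_nil (h : Hyp → Datum →. Hyp) : itLearner h [] = Part.some none := rfl

theorem itLearner_concat (h : Hyp → Datum →. Hyp) (σ : List Datum) (x : Datum) :
    itLearner h (σ ++ [x]) = (itLearner h σ).bind fun e => h e x := by
  simp [itLearner]

/-! ### Bounded memory states learners -/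

/-- The state after a finite sequence: `0` after the empty sequence, and
`s (state after σ) x` after `σ ⌢ x`. -/
def bmsState (s : ℕ → Datum →. ℕ) (σ : List Datum) : Part ℕ :=
  σ.foldl (fun q x => q.bind fun q' => s q' x) (Part.some 0)

theorem bmsState_nil (s : ℕ → Datum →. ℕ) : bmsState s [] = Part.some 0 := rfl

theorem bmsState_concat (s : ℕ → Datum →. ℕ) (σ : List Datum) (x : Datum) :
    bmsState s (σ ++ [x]) = (bmsState s σ).bind fun q => s q x := by
  simp [bmsState]

/-- The learner generated by the hypothesis generating function `h` and the state transition
function `s`: the value at `σ ⌢ x` is `h (state after σ) x`, the value at the empty sequence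
is `?`. -/
def bmsLearner (h : ℕ → Datum →. Hyp) (s : ℕ → Datum →. ℕ) (σ : List Datum) : Part Hyp :=
  match σ.getLast? with
  | none => Part.some none
  | some x => (bmsState s σ.dropLast).bind fun q => h q x

theorem bmsLearner_nil (h : ℕ → Datum →. Hyp) (s : ℕ → Datum →. ℕ) :
    bmsLearner h s [] = Part.some none := rfl

theorem bmsLearner_concat (h : ℕ → Datum →. Hyp) (s : ℕ → Datum →. ℕ) (σ : List Datum)
    (x : Datum) : bmsLearner h s (σ ++ [x]) = (bmsState s σ).bind fun q => h q x := by
  simp [bmsLearner]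

/-- `BMS_*`: only finitely many memory states are used on `T`. -/
def UsesFinitelyManyStates (s : ℕ → Datum →. ℕ) (T : ℕ → Datum) : Prop :=
  {q : ℕ | ∃ t, q ∈ bmsState s (initSeg T t)}.Finite

/-! ### Learning sequences, convergence and restrictions -/

/-- `e` is the (everywhere defined) learning sequence of `M` on `T`. -/
def IsLearningSeq (M : List Datum →. Hyp) (T : ℕ → Datum) (e : ℕ → Hyp) : Prop :=
  ∀ t, e t ∈ M (initSeg T t)

/-- Explanatory convergence of the learning sequence `e` on `T`. -/
def Ex (e : ℕ → Hyp) (T : ℕ → Datum) : Prop :=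
  ∃ t₀, IsIndexOf (e t₀) (content T) ∧ ∀ t, t₀ ≤ t → e t ≠ none → e t = e t₀

/-- Strongly non-U-shaped. -/
def SNU (e : ℕ → Hyp) (T : ℕ → Datum) : Prop :=
  ∀ r s t, r ≤ s → s ≤ t →
    IsIndexOf (e r) (content T) → IsIndexOf (e t) (content T) → e r = e s

/-- Strongly decisive. -/
def SDec (e : ℕ → Hyp) (_T : ℕ → Datum) : Prop :=
  ∀ r s t, r ≤ s → s ≤ t → ∀ p q, e r = some p → e t = some q → W p = W q → e r = e s

/-- Conservative. -/
def Conv (e : ℕ → Hyp) (T : ℕ → Datum) : Prop :=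
  ∀ s t, s ≤ t → ∀ p, e s = some p → listContent (initSeg T t) ⊆ W p → e s = e t

/-! ### Learning criteria -/

/-- `[It Txt δ Ex]`: the collections of languages all of whose members are `δ Ex`-learned from
all of their texts by one iterative learner. -/
def ItTxtEx (δ : (ℕ → Hyp) → (ℕ → Datum) → Prop) : Set (Set (Set ℕ)) :=
  {C | (∀ L ∈ C, IsLanguage L) ∧
    ∃ h : Hyp → Datum →. Hyp, Partrec₂ h ∧
      ∀ L ∈ C, ∀ T, IsText T L →
        ∃ e, IsLearningSeq (itLearner h) T e ∧ δ e T ∧ Ex e T}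

/-- `[Txt BMS_* δ Ex]`: the collections of languages all of whose members are `δ Ex`-learned from
all of their texts by one bounded memory states learner using only finitely many states on each
of these texts. -/
def TxtBMSStarEx (δ : (ℕ → Hyp) → (ℕ → Datum) → Prop) : Set (Set (Set ℕ)) :=
  {C | (∀ L ∈ C, IsLanguage L) ∧
    ∃ (h : ℕ → Datum →. Hyp) (s : ℕ → Datum →. ℕ), Partrec₂ h ∧ Partrec₂ s ∧
      (∀ q x, (h q x).Dom ↔ (s q x).Dom) ∧
      ∀ L ∈ C, ∀ T, IsText T L →
        UsesFinitelyManyStates s T ∧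
        ∃ e, IsLearningSeq (bmsLearner h s) T e ∧ δ e T ∧ Ex e T}

end InductiveInference

namespace InductiveInference

open Nat.Partrec (Code)

/-! Inclusion: a memory state can store the iterative learner's current hypothesis. The learning
sequence is unchanged, so every δ carries over, and Ex-success bounds the number of hypotheses and
hence of states.

Strictness for all three δ comes from one class, `separatingClass`. A bounded memory states learner
for it is both conservative and strongly decisive: it conjectures `evens` until a marker `2 * m + 1`
appears, then `smallLang m`, and `largeLang m` only after two distinct numbers `2 * j` above the
threshold coded in `m`. Its memory counts these numbers without changing the hypothesis.

An iterative learner can remember only through its hypothesis, and SNU forbids changing a correct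
one (`ItLearnsSNU.locked`). Let it lock on `evens` after reading the even numbers below `2 * n`;
from then on it forgets every further even number. By the recursion theorem (`exists_program`) there
is a program `c` that knows the marker of `m = ⟨n, c⟩` and searches for `j ≥ n` such that `2 * j`
changes the hypothesis held after marker and pauses. If it finds `j`, then `smallLang m` contains `2
* j`; the learner may have read `2 * j` before the marker and forgotten it, so its hypothesis after
the pauses is already correct for `smallLang m`, and yet `2 * j` changes it. If it finds nothing,
the learner stays with its hypothesis for `smallLang m` on a text for `largeLang m`. -/

/-! ### Iterative learners as bounded memory states learners -/

/-- The state transition function that stores the current hypothesis of an iterative learner. -/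
def storeState (h : Hyp → Datum →. Hyp) : ℕ → Datum →. ℕ := fun q x =>
  (h (Denumerable.ofNat Hyp q) x).map Encodable.encode

/-- The hypothesis generating function belonging to `storeState`. -/
def storeHyp (h : Hyp → Datum →. Hyp) : ℕ → Datum →. Hyp := fun q x =>
  h (Denumerable.ofNat Hyp q) x

theorem bmsState_storeState (h : Hyp → Datum →. Hyp) (σ : List Datum) :
    bmsState (storeState h) σ = (itLearner h σ).map Encodable.encode := by
  induction σ using List.reverseRecOn with
  -- The initial state `0` is the code of `?`, which is the initial hypothesis.
  | nil => simp [bmsState_nil, itLearner_nil]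
  | append_singleton σ x ih =>
    rw [bmsState_concat, itLearner_concat, ih, Part.bind_map, Part.map_bind]
    simp [storeState]

theorem bmsLearner_store (h : Hyp → Datum →. Hyp) (σ : List Datum) :
    bmsLearner (storeHyp h) (storeState h) σ = itLearner h σ := by
  induction σ using List.reverseRecOn with
  | nil => rfl
  | append_singleton σ x _ =>
    rw [bmsLearner_concat, itLearner_concat, bmsState_storeState, Part.bind_map]
    simp [storeHyp]

theorem finite_range_of_ex {e : ℕ → Hyp} {T : ℕ → Datum} (h : Ex e T) :
    (Set.range e).Finite := by
  obtain ⟨t₀, -, h₀⟩ := h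
  refine (((Set.finite_le_nat t₀).image e).union (Set.finite_singleton none)).subset ?_
  rintro _ ⟨t, rfl⟩
  by_cases hn : e t = none
  · exact Or.inr hn
  · rcases le_total t t₀ with ht | ht
    · exact Or.inl ⟨t, ht, rfl⟩
    · exact Or.inl ⟨t₀, le_refl t₀, (h₀ t ht hn).symm⟩

theorem itTxtEx_subset (δ : (ℕ → Hyp) → (ℕ → Datum) → Prop) : ItTxtEx δ ⊆ TxtBMSStarEx δ := by
  rintro C ⟨hC, h, hh, hL⟩
  have hc : Partrec₂ (storeHyp h) :=
    hh.comp ((Computable.ofNat Hyp).comp Computable.fst) Computable.snd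
  refine ⟨hC, storeHyp h, storeState h, hc,
    Partrec.map hc (Computable.encode.comp Computable.snd).to₂, fun q x => Iff.rfl, ?_⟩
  intro L hLC T hT
  obtain ⟨e, he, hδ, hex⟩ := hL L hLC T hT
  refine ⟨((finite_range_of_ex hex).image Encodable.encode).subset ?_, e, ?_, hδ, hex⟩
  · rintro q ⟨t, hq⟩
    rw [bmsState_storeState, Part.mem_map_iff] at hq
    obtain ⟨a, ha, rfl⟩ := hq
    exact ⟨a, ⟨t, Part.mem_unique (he t) ha⟩, rfl⟩
  · intro t
    rw [bmsLearner_store]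
    exact he t

/-! ### Texts -/

/-- The sequence `T` preceded by the finite sequence `σ`. -/
def prepend (σ : List Datum) (T : ℕ → Datum) (t : ℕ) : Datum :=
  if h : t < σ.length then σ[t] else T (t - σ.length)

theorem initSeg_succ (T : ℕ → Datum) (t : ℕ) : initSeg T (t + 1) = initSeg T t ++ [T t] := by
  simp [initSeg, List.range_succ]

theorem length_initSeg (T : ℕ → Datum) (t : ℕ) : (initSeg T t).length = t := by
  simp [initSeg]

theorem mem_initSeg {T : ℕ → Datum} {t : ℕ} {x : Datum} :
    x ∈ initSeg T t ↔ ∃ s < t, T s = x := by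
  simp [initSeg]

theorem initSeg_prepend (σ : List Datum) (T : ℕ → Datum) (k : ℕ) :
    initSeg (prepend σ T) (σ.length + k) = σ ++ initSeg T k := by
  apply List.ext_getElem
  · simp [initSeg]
  · intro i h₁ h₂
    by_cases hi : i < σ.length
    · simp [initSeg, prepend, hi]
    · simp [initSeg, prepend, hi, List.getElem_append]

theorem initSeg_prepend_length (σ : List Datum) (T : ℕ → Datum) :
    initSeg (prepend σ T) σ.length = σ := by
  simpa [initSeg] using initSeg_prepend σ T 0

theorem initSeg_prepend_append (σ τ : List Datum) (T : ℕ → Datum) :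
    initSeg (prepend (σ ++ τ) T) σ.length = σ := by
  apply List.ext_getElem (length_initSeg _ _)
  intro i h₁ h₂
  have : i < (σ ++ τ).length := by rw [List.length_append]; omega
  simp only [initSeg, List.getElem_map, List.getElem_range, prepend, this, dite_true]
  exact List.getElem_append_left h₂

theorem content_prepend (σ : List Datum) (T : ℕ → Datum) :
    content (prepend σ T) = listContent σ ∪ content T := by
  ext n
  constructor
  · rintro ⟨t, ht⟩
    by_cases h : t < σ.length
    · left
      simp only [prepend, h, dite_true] at ht
      change some n ∈ σ
      exact ht ▸ List.getElem_mem h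
    · right
      simp only [prepend, h, dite_false] at ht
      exact ⟨_, ht⟩
  · rintro (h | ⟨t, ht⟩)
    · obtain ⟨i, hi, h⟩ := List.getElem_of_mem h
      exact ⟨i, by simp [prepend, hi, h]⟩
    · exact ⟨σ.length + t, by simp [prepend, ht]⟩

theorem exists_isText (L : Set ℕ) : ∃ T, IsText T L := by
  classical
  refine ⟨fun n => if n ∈ L then some n else none, ?_⟩
  ext n
  simp only [content, Set.mem_ofPred_eq]
  constructor
  · rintro ⟨t, ht⟩
    split_ifs at ht with h
    cases ht
    exact h
  · exact fun h => ⟨n, by simp [h]⟩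

theorem listContent_append (σ τ : List Datum) :
    listContent (σ ++ τ) = listContent σ ∪ listContent τ := by
  ext; simp [listContent]

theorem listContent_initSeg_subset (T : ℕ → Datum) (t : ℕ) :
    listContent (initSeg T t) ⊆ content T := by
  intro n hn
  obtain ⟨s, -, h⟩ := mem_initSeg.1 hn
  exact ⟨s, h⟩

/-! ### Strongly non-U-shaped iterative learners -/

/-- The iterative learner generated by `h` learns `L` explanatorily and in a strongly
non-U-shaped way. -/
def ItLearnsSNU (h : Hyp → Datum →. Hyp) (L : Set ℕ) : Prop :=
  ∀ T, IsText T L → ∃ e, IsLearningSeq (itLearner h) T e ∧ SNU e T ∧ Ex e T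

theorem itLearner_append {h : Hyp → Datum →. Hyp} {σ : List Datum} {a : Hyp}
    (ha : a ∈ itLearner h σ) (τ : List Datum) :
    itLearner h (σ ++ τ) = τ.foldl (fun e x => e.bind fun e' => h e' x) (Part.some a) := by
  rw [itLearner, List.foldl_append, ← Part.eq_some_iff.2 ha, itLearner]

/-- An iterative learner has no memory besides its hypothesis, so equal hypotheses have equal
futures. -/
theorem itLearner_append_congr {h : Hyp → Datum →. Hyp} {σ σ' : List Datum} {a : Hyp}
    (ha : a ∈ itLearner h σ) (ha' : a ∈ itLearner h σ') (τ : List Datum) :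
    itLearner h (σ ++ τ) = itLearner h (σ' ++ τ) := by
  rw [itLearner_append ha, itLearner_append ha']

/-- A hypothesis other than `?` either comes before the point of convergence or coincides with the
final hypothesis. This supplies the later correct hypothesis that SNU requires. -/
theorem exists_isIndexOf_ge {e : ℕ → Hyp} {T : ℕ → Datum} (h : Ex e T) {s : ℕ}
    (hs : e s ≠ none) : ∃ t, s ≤ t ∧ IsIndexOf (e t) (content T) := by
  obtain ⟨t₀, h₀, h₁⟩ := h
  rcases le_total s t₀ with hst | hst
  · exact ⟨t₀, hst, h₀⟩
  · exact ⟨s, le_rfl, h₁ s hst hs ▸ h₀⟩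

/-- Once a strongly non-U-shaped iterative learner has a correct hypothesis, data from the
language do not change it. -/
theorem ItLearnsSNU.locked {h : Hyp → Datum →. Hyp} {L : Set ℕ} (hL : ItLearnsSNU h L)
    {σ τ : List Datum} {p : ℕ} (hσ : listContent σ ⊆ L) (hp : some p ∈ itLearner h σ)
    (hW : W p = L) (hτ : listContent τ ⊆ L) : some p ∈ itLearner h (σ ++ τ) := by
  obtain ⟨T, hT⟩ := exists_isText L
  -- The second copy of `σ` deals with the value `?` after `σ ++ τ`: since `?` is also the initial
  -- hypothesis, rereading `σ` restores `p`, and SNU applies between the two occurrences of `p`.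
  have hT' : content (prepend (σ ++ τ ++ σ) T) = L := by
    rw [content_prepend, listContent_append, listContent_append, hT]
    simp [hσ, hτ]
  obtain ⟨e, he, hsnu, hex⟩ := hL _ hT'
  have e₁ := he σ.length
  rw [List.append_assoc, initSeg_prepend_append] at e₁
  have e₂ := he (σ ++ τ).length
  rw [initSeg_prepend_append] at e₂
  have e₃ := he (σ ++ τ ++ σ).length
  rw [initSeg_prepend_length] at e₃
  have i₁ : e σ.length = some p := Part.mem_unique e₁ hp
  have c₁ : IsIndexOf (e σ.length) (content (prepend (σ ++ τ ++ σ) T)) := ⟨p, i₁, hW.trans hT'.symm⟩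
  have l₁ : σ.length ≤ (σ ++ τ).length := by simp
  have key : e σ.length = e (σ ++ τ).length := by
    by_cases hn : e (σ ++ τ).length = none
    · have hnone : none ∈ itLearner h (σ ++ τ) := hn ▸ e₂
      rw [itLearner_append_congr hnone (itLearner_nil h ▸ Part.mem_some none : none ∈ itLearner h [])] at e₃
      have i₃ : e (σ ++ τ ++ σ).length = some p := Part.mem_unique e₃ hp
      exact hsnu _ _ _ l₁ (by simp) c₁ ⟨p, i₃, hW.trans hT'.symm⟩
    · obtain ⟨t, ht, hc⟩ := exists_isIndexOf_ge hex hn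
      exact hsnu _ _ _ l₁ ht c₁ hc
  rw [← i₁, key]
  exact e₂

/-- Some hypothesis on a text, not before a given time, is correct and final. -/
theorem ItLearnsSNU.exists_correct {h : Hyp → Datum →. Hyp} {L : Set ℕ} (hL : ItLearnsSNU h L)
    {T : ℕ → Datum} (hT : IsText T L) (n : ℕ) :
    ∃ t, n ≤ t ∧ ∃ p, some p ∈ itLearner h (initSeg T t) ∧ W p = L := by
  obtain ⟨e, he, -, t₀, ⟨p, hp, hW⟩, -⟩ := hL T hT
  have h₀ := he t₀
  rw [hp] at h₀
  -- Ex alone would permit `?` after `t₀`; locking excludes it, so `p` is still held at `t₀ + n`.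
  refine ⟨t₀ + n, by omega, p, ?_, hW.trans hT⟩
  induction n with
  | zero => exact h₀
  | succ n ih =>
    rw [← add_assoc, initSeg_succ]
    refine hL.locked ?_ ih (hW.trans hT) ?_
    · exact (listContent_initSeg_subset T _).trans hT.subset
    · intro a ha
      rw [← hT]
      exact ⟨_, (List.mem_singleton.1 ha).symm⟩

/-! ### Indices -/

/-- The s-m-n theorem for domains: a partial computable function of two arguments yields a
computable sequence of indices for the domains of its sections. -/
theorem exists_computable_index {f : ℕ → ℕ →. ℕ} (hf : Partrec₂ f) :
    ∃ g : ℕ → ℕ, Computable g ∧ ∀ m, W (g m) = {a | (f m a).Dom} := by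
  obtain ⟨c, hc⟩ := Code.exists_code.1 (Partrec₂.unpaired'.2 hf)
  refine ⟨fun m => Encodable.encode (Code.curry c m), Computable.encode.comp
    (Code.primrec₂_curry.to_comp.comp (Computable.const c) Computable.id), fun m => ?_⟩
  ext a
  simp [W, phi, Code.eval_curry, hc, Nat.unpaired]

theorem isLanguage_W (p : ℕ) : IsLanguage (W p) := by
  have : Partrec (phi p) := Code.eval_part.comp (Computable.const _) Computable.id
  refine (Partrec.map this (g := fun _ _ => ()) (Computable.const ()).to₂).of_eq fun n => ?_
  refine Part.ext' ?_ fun _ _ => rfl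
  simp [W, Part.assert]

/-! ### The separating class -/

/-- The language of all even numbers. -/
def evens : Set ℕ := {a | a % 2 = 0}

/-- For `m = ⟨n, c⟩`: the even numbers below `2 * n`, the marker `2 * m + 1`, and twice the value
of the program `c` at `0`, if it exists. -/
def smallLang (m : ℕ) : Set ℕ :=
  {a | (a % 2 = 0 ∧ a / 2 < m.unpair.1) ∨ a = 2 * m + 1 ∨ ∃ j ∈ phi m.unpair.2 0, a = 2 * j}

/-- All even numbers together with the marker `2 * m + 1`. -/
def largeLang (m : ℕ) : Set ℕ := {a | a % 2 = 0 ∨ a = 2 * m + 1}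

/-- The class separating bounded memory states learning from iterative learning. -/
def separatingClass : Set (Set ℕ) :=
  {evens} ∪ Set.range smallLang ∪ Set.range largeLang

theorem mem_evens {a : ℕ} : a ∈ evens ↔ a % 2 = 0 := Iff.rfl

theorem mem_smallLang {m a : ℕ} : a ∈ smallLang m ↔
    (a % 2 = 0 ∧ a / 2 < m.unpair.1) ∨ a = 2 * m + 1 ∨ ∃ j ∈ phi m.unpair.2 0, a = 2 * j := Iff.rfl

theorem mem_largeLang {m a : ℕ} : a ∈ largeLang m ↔ a % 2 = 0 ∨ a = 2 * m + 1 := Iff.rfl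

theorem primrecPred_mod_two (r : ℕ) : PrimrecPred fun a : ℕ => a % 2 = r :=
  Primrec.eq.comp (Primrec.nat_mod.comp .id (.const 2)) (.const r)

theorem primrec_half : Primrec fun a : ℕ => a / 2 := Primrec.nat_div.comp .id (.const 2)

theorem primrec_marker : Primrec fun m : ℕ => 2 * m + 1 :=
  Primrec.succ.comp (Primrec.nat_mul.comp (.const 2) .id)

theorem exists_index_largeLang : ∃ g : ℕ → ℕ, Computable g ∧ ∀ m, W (g m) = largeLang m := by
  have hp : PrimrecPred fun p : ℕ × ℕ => p.2 % 2 = 0 ∨ p.2 = 2 * p.1 + 1 :=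
    ((primrecPred_mod_two 0).comp .snd).or (Primrec.eq.comp .snd (primrec_marker.comp .fst))
  have hf : Partrec₂ fun m a : ℕ =>
      ((if a % 2 = 0 ∨ a = 2 * m + 1 then some 0 else none : Option ℕ) : Part ℕ) :=
    (Computable.ofOption (Primrec.ite hp (.const (some 0)) (.const none)).to_comp).to₂
  obtain ⟨g, hg, hW⟩ := exists_computable_index hf
  refine ⟨g, hg, fun m => (hW m).trans ?_⟩
  ext a
  by_cases h : a % 2 = 0 ∨ a = 2 * m + 1 <;> simp [h, mem_largeLang]

theorem exists_index_evens : ∃ p, W p = evens := by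
  have hf : Partrec₂ fun _ a : ℕ =>
      ((if a % 2 = 0 then some 0 else none : Option ℕ) : Part ℕ) :=
    (Computable.ofOption (Primrec.ite ((primrecPred_mod_two 0).comp .snd)
      (.const (some 0)) (.const none)).to_comp).to₂
  obtain ⟨g, -, hW⟩ := exists_computable_index hf
  refine ⟨g 0, (hW 0).trans ?_⟩
  ext a
  by_cases h : a % 2 = 0 <;> simp [h, mem_evens]

theorem exists_index_smallLang : ∃ g : ℕ → ℕ, Computable g ∧ ∀ m, W (g m) = smallLang m := by
  have hp : PrimrecPred fun p : ℕ × ℕ =>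
      (p.2 % 2 = 0 ∧ p.2 / 2 < p.1.unpair.1) ∨ p.2 = 2 * p.1 + 1 :=
    (((primrecPred_mod_two 0).comp .snd).and (Primrec.nat_lt.comp (primrec_half.comp .snd)
      (Primrec.fst.comp (Primrec.unpair.comp .fst)))).or
      (Primrec.eq.comp .snd (primrec_marker.comp .fst))
  have hq : Primrec₂ fun (p : ℕ × ℕ) (j : ℕ) => if p.2 = 2 * j then some 0 else (none : Option ℕ) :=
    (Primrec.ite (Primrec.eq.comp (Primrec.snd.comp .fst)
      (Primrec.nat_mul.comp (.const 2) .snd)) (.const (some 0)) (.const none)).to₂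
  have hphi : Partrec fun p : ℕ × ℕ => phi p.1.unpair.2 0 :=
    Code.eval_part.comp ((Computable.ofNat Code).comp
      (Computable.snd.comp (Computable.unpair.comp .fst))) (Computable.const 0)
  -- The decidable part is tested before the program is run, so a diverging program does not remove
  -- its elements.
  have hf : Partrec₂ fun m a : ℕ =>
      (bif decide ((a % 2 = 0 ∧ a / 2 < m.unpair.1) ∨ a = 2 * m + 1) then Part.some 0
        else (phi m.unpair.2 0).bind fun j =>
          ((if a = 2 * j then some 0 else none : Option ℕ) : Part ℕ)) :=
    (Partrec.cond hp.decide.to_comp (Computable.const 0).partrec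
      (hphi.bind (Computable.ofOption hq.to_comp).to₂)).to₂
  obtain ⟨g, hg, hW⟩ := exists_computable_index hf
  refine ⟨g, hg, fun m => (hW m).trans ?_⟩
  ext a
  by_cases h : (a % 2 = 0 ∧ a / 2 < m.unpair.1) ∨ a = 2 * m + 1
  · have : a ∈ smallLang m := by
      rw [mem_smallLang, ← or_assoc]; exact Or.inl h
    simp only [Set.mem_ofPred_eq, decide_eq_true h, cond_true, this, iff_true]
    trivial
  · rw [mem_smallLang, ← or_assoc, or_iff_right h]
    simp only [Set.mem_ofPred_eq, decide_eq_false h, cond_false]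
    rw [Part.dom_iff_mem]
    simp only [Part.mem_bind_iff]
    constructor
    · rintro ⟨y, j, hj, hy⟩
      refine ⟨j, hj, ?_⟩
      by_contra hne
      simp [hne] at hy
    · rintro ⟨j, hj, rfl⟩
      exact ⟨0, j, hj, by simp⟩

theorem isLanguage_of_mem_separatingClass {L : Set ℕ} (hL : L ∈ separatingClass) :
    IsLanguage L := by
  rcases hL with (rfl | ⟨m, rfl⟩) | ⟨m, rfl⟩
  · obtain ⟨p, hp⟩ := exists_index_evens
    exact hp ▸ isLanguage_W p
  · obtain ⟨g, -, hg⟩ := exists_index_smallLang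
    exact hg m ▸ isLanguage_W (g m)
  · obtain ⟨g, -, hg⟩ := exists_index_largeLang
    exact hg m ▸ isLanguage_W (g m)

theorem evens_ne_smallLang (m : ℕ) : evens ≠ smallLang m := by
  intro h
  have : 2 * m + 1 ∈ evens := h ▸ Or.inr (Or.inl rfl)
  rw [mem_evens] at this
  omega

theorem evens_ne_largeLang (m : ℕ) : evens ≠ largeLang m := by
  intro h
  have : 2 * m + 1 ∈ evens := h ▸ Or.inr rfl
  rw [mem_evens] at this
  omega

/-- A language `smallLang m` with `m = ⟨n, c⟩` contains at most one number `2 * j` with `n ≤ j`. -/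
theorem eq_of_mem_smallLang {m i j : ℕ} (hi : m.unpair.1 ≤ i) (hj : m.unpair.1 ≤ j)
    (h₁ : 2 * i ∈ smallLang m) (h₂ : 2 * j ∈ smallLang m) : i = j := by
  have key : ∀ k, m.unpair.1 ≤ k → 2 * k ∈ smallLang m → k ∈ phi m.unpair.2 0 := by
    intro k hk h
    rcases h with ⟨-, h⟩ | h | ⟨l, hl, h⟩
    · omega
    · omega
    · obtain rfl : k = l := by omega
      exact hl
  exact Part.mem_unique (key i hi h₁) (key j hj h₂)

/-- The large language contains two consecutive even numbers from the threshold on; the small one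
contains at most one number there. -/
theorem smallLang_ne_largeLang (m m' : ℕ) : smallLang m ≠ largeLang m' := by
  intro h
  have := eq_of_mem_smallLang (m := m) (i := m.unpair.1) (j := m.unpair.1 + 1) le_rfl (by omega)
    (h ▸ Or.inl (by omega)) (h ▸ Or.inl (by omega))
  omega

/-! ### A bounded memory states learner for the separating class -/

/-- State transitions. A state `(0, _)` means that no marker has been seen; `(m + 1, p)` means that
the marker `2 * m + 1` has been seen, with `m = ⟨n, c⟩`, and that among the numbers `2 * j` with
`n ≤ j` seen afterwards there is none (`p = 0`), exactly one, `2 * j` (`p = j + 2`), or more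
(`p = 1`). -/
def markerStep (q : ℕ × ℕ) (x : Datum) : ℕ × ℕ :=
  Option.casesOn x q fun a =>
    if q.1 = 0 then if a % 2 = 1 then (a / 2 + 1, 0) else q
    else if a % 2 = 0 ∧ (q.1 - 1).unpair.1 ≤ a / 2 then
      if q.2 = 0 then (q.1, a / 2 + 2) else if q.2 = 1 ∨ q.2 = a / 2 + 2 then q else (q.1, 1)
    else q

/-- The hypothesis for a state, given an index of `evens` and index functions for `smallLang` and
`largeLang`. -/
def markerHyp (pe : ℕ) (gs gl : ℕ → ℕ) (q : ℕ × ℕ) : ℕ :=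
  bif decide (q.1 = 0) then pe else bif decide (q.2 = 1) then gl (q.1 - 1) else gs (q.1 - 1)

theorem primrec_markerStep : Primrec₂ markerStep := by
  have q : Primrec fun p : ((ℕ × ℕ) × Datum) × ℕ => p.1.1 := Primrec.fst.comp .fst
  have q₁ := Primrec.fst.comp q
  have q₂ := Primrec.snd.comp q
  have a : Primrec fun p : ((ℕ × ℕ) × Datum) × ℕ => p.2 := Primrec.snd
  have a₂ := primrec_half.comp a
  have v := Primrec.succ.comp (Primrec.succ.comp a₂)
  refine Primrec.option_casesOn (f := fun p : (ℕ × ℕ) × Datum => p.1) .snd .fst ?_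
  refine Primrec.ite (Primrec.eq.comp q₁ (.const 0))
    (Primrec.ite ((primrecPred_mod_two 1).comp a) ((Primrec.succ.comp a₂).pair (.const 0)) q)
    (Primrec.ite (((primrecPred_mod_two 0).comp a).and (Primrec.nat_le.comp
      (Primrec.fst.comp (Primrec.unpair.comp (Primrec.pred.comp q₁))) a₂)) ?_ q)
  exact Primrec.ite (Primrec.eq.comp q₂ (.const 0)) (q₁.pair v)
    (Primrec.ite ((Primrec.eq.comp q₂ (.const 1)).or (Primrec.eq.comp q₂ v)) q
      (q₁.pair (.const 1)))

theorem computable_markerHyp (pe : ℕ) {gs gl : ℕ → ℕ} (hs : Computable gs) (hl : Computable gl) :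
    Computable (markerHyp pe gs gl) := by
  have d : Computable fun q : ℕ × ℕ => q.1 - 1 := (Primrec.pred.comp .fst).to_comp
  exact Computable.cond (Primrec.eq.comp .fst (.const 0)).decide.to_comp (.const pe)
    (Computable.cond (Primrec.eq.comp .snd (.const 1)).decide.to_comp (hl.comp d) (hs.comp d))

/-- A number that increases with each change of the state. -/
def markerRank (q : ℕ × ℕ) : ℕ :=
  if q.1 = 0 then 0 else if q.2 = 0 then 1 else if q.2 = 1 then 3 else 2

theorem markerStep_none (q : ℕ × ℕ) : markerStep q none = q := rfl

theorem markerStep_some (q : ℕ × ℕ) (a : ℕ) : markerStep q (some a) =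
    if q.1 = 0 then if a % 2 = 1 then (a / 2 + 1, 0) else q
    else if a % 2 = 0 ∧ (q.1 - 1).unpair.1 ≤ a / 2 then
      if q.2 = 0 then (q.1, a / 2 + 2) else if q.2 = 1 ∨ q.2 = a / 2 + 2 then q else (q.1, 1)
    else q := rfl

theorem markerRank_le (q : ℕ × ℕ) : markerRank q ≤ 3 := by
  unfold markerRank; split_ifs <;> omega

theorem markerStep_eq_or_rank_lt (q : ℕ × ℕ) (x : Datum) :
    markerStep q x = q ∨ markerRank q < markerRank (markerStep q x) := by
  rcases x with _ | a
  · exact Or.inl rfl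
  · rw [markerStep_some]
    split_ifs with h₁ h₂ h₃ h₄ h₅
    · right; simp [markerRank, h₁]
    · left; rfl
    · right; simp [markerRank, h₁, h₄]
    · left; rfl
    · right
      have : q.2 ≠ 1 := fun h => h₅ (Or.inl h)
      simp [markerRank, h₁, h₄, this]
    · left; rfl

/-- The state after the first `t` data of `T`. -/
def markerRun (T : ℕ → Datum) : ℕ → ℕ × ℕ
  | 0 => (0, 0)
  | t + 1 => markerStep (markerRun T t) (T t)

/-- The hypothesis after the first `t` data of `T`. -/
def markerSeq (pe : ℕ) (gs gl : ℕ → ℕ) (T : ℕ → Datum) : ℕ → Hyp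
  | 0 => none
  | t + 1 => some (markerHyp pe gs gl (markerRun T (t + 1)))

theorem monotone_markerRank (T : ℕ → Datum) : Monotone fun t => markerRank (markerRun T t) := by
  refine monotone_nat_of_le_succ fun t => ?_
  rcases markerStep_eq_or_rank_lt (markerRun T t) (T t) with h | h
  · simp [markerRun, h]
  · exact h.le

/-- The rank is monotone and strictly increases with each change of state, so equal ranks at two
times leave no room for a change between them. -/
theorem markerRun_eq_of_rank_eq {T : ℕ → Datum} {s t : ℕ} (hst : s ≤ t)
    (h : markerRank (markerRun T s) = markerRank (markerRun T t)) :
    markerRun T t = markerRun T s := by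
  induction t, hst using Nat.le_induction with
  | base => rfl
  | succ t hst ih =>
    have h₁ := monotone_markerRank T hst
    have h₂ := monotone_markerRank T (Nat.le_add_right t 1)
    simp only at h₁ h₂
    rw [← ih (by omega)]
    rcases markerStep_eq_or_rank_lt (markerRun T t) (T t) with h' | h'
    · exact h'
    · simp only [markerRun] at h h₂
      omega

theorem exists_markerRun_eventually_const (T : ℕ → Datum) :
    ∃ t₁, ∀ t, t₁ ≤ t → markerRun T t = markerRun T t₁ := by
  have hfin : (Set.range fun t => markerRank (markerRun T t)).Finite :=
    (Set.finite_Iic 3).subset (by rintro _ ⟨t, rfl⟩; exact markerRank_le _)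
  obtain ⟨_, ⟨t₁, rfl⟩, hmax⟩ := hfin.exists_maximal ⟨_, ⟨0, rfl⟩⟩
  exact ⟨t₁, fun t ht => markerRun_eq_of_rank_eq ht
    (le_antisymm (monotone_markerRank T ht) (hmax ⟨t, rfl⟩ (monotone_markerRank T ht)))⟩

/-- What the state after seeing the data in `A` says about `A`. -/
structure MarkerInv (A : Set ℕ) (q : ℕ × ℕ) : Prop where
  even : q.1 = 0 → A ⊆ evens
  marker : ∀ m, q.1 = m + 1 → 2 * m + 1 ∈ A
  one : ∀ m j, q.1 = m + 1 → q.2 = j + 2 → m.unpair.1 ≤ j ∧ 2 * j ∈ A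
  two : ∀ m, q.1 = m + 1 → q.2 = 1 →
    ∃ i j, m.unpair.1 ≤ i ∧ m.unpair.1 ≤ j ∧ i ≠ j ∧ 2 * i ∈ A ∧ 2 * j ∈ A

theorem MarkerInv.step_some {A : Set ℕ} {q : ℕ × ℕ} (h : MarkerInv A q) (a : ℕ) :
    MarkerInv (insert a A) (markerStep q (some a)) := by
  -- Serves all branches that keep the state; the excluded case is the first marker, which would
  -- violate `even`.
  have mono : ¬ (q.1 = 0 ∧ a % 2 = 1) → MarkerInv (insert a A) q := fun hq =>
    { even := fun h₀ => Set.insert_subset (mem_evens.2 (by omega)) (h.even h₀)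
      marker := fun m hm => Or.inr (h.marker m hm)
      one := fun m j hm hj => ⟨(h.one m j hm hj).1, Or.inr (h.one m j hm hj).2⟩
      two := fun m hm hp => by
        obtain ⟨i, j, h₁, h₂, h₃, h₄, h₅⟩ := h.two m hm hp
        exact ⟨i, j, h₁, h₂, h₃, Or.inr h₄, Or.inr h₅⟩ }
  rw [markerStep_some]
  split_ifs with h₁ h₂ h₃ h₄ h₅
  · refine ⟨fun h => by simp at h, fun m hm => Or.inl ?_, fun m j _ hj => by simp at hj,
      fun m _ hp => by simp at hp⟩
    simp only [Nat.add_right_cancel_iff] at hm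
    omega
  · exact mono fun h => h₂ h.2
  · refine ⟨fun h => absurd h h₁, fun m hm => Or.inr (h.marker m hm), fun m j hm hj => ?_,
      fun m _ hp => by simp at hp⟩
    simp only [Nat.add_right_cancel_iff] at hm hj
    rw [hm] at h₃
    exact ⟨hj ▸ h₃.2, Or.inl (by omega)⟩
  · exact mono fun h => h₁ h.1
  · refine ⟨fun h => absurd h h₁, fun m hm => Or.inr (h.marker m hm), fun m j _ hj => by simp at hj,
      fun m hm _ => ?_⟩
    simp only at hm
    obtain ⟨h₆, h₇⟩ := h.one m (q.2 - 2) hm (by omega)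
    rw [hm] at h₃
    exact ⟨q.2 - 2, a / 2, h₆, h₃.2, by omega, Or.inr h₇, Or.inl (by omega)⟩
  · exact mono fun h => h₁ h.1

theorem listContent_initSeg_succ (T : ℕ → Datum) (t : ℕ) :
    listContent (initSeg T (t + 1)) = listContent (initSeg T t) ∪ {a | T t = some a} := by
  rw [initSeg_succ, listContent_append]
  congr 1
  ext a
  simp [listContent, eq_comm]

theorem markerInv_run (T : ℕ → Datum) (t : ℕ) :
    MarkerInv (listContent (initSeg T t)) (markerRun T t) := by
  induction t with
  | zero =>
    refine ⟨fun _ => ?_, fun m hm => ?_, fun m j hm => ?_, fun m hm => ?_⟩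
    · rintro a ha
      obtain ⟨s, hs, -⟩ := mem_initSeg.1 ha
      omega
    all_goals simp [markerRun] at hm
  | succ t ih =>
    rw [listContent_initSeg_succ, markerRun]
    cases hx : T t with
    | none => simpa [markerStep_none] using ih
    | some a =>
      have : listContent (initSeg T t) ∪ {b | some a = some b} =
          insert a (listContent (initSeg T t)) := by
        ext b; simp [eq_comm]
      rw [this]
      exact ih.step_some a

/-- The language conjectured in a state. -/
def markerLang (q : ℕ × ℕ) : Set ℕ :=
  if q.1 = 0 then evens else if q.2 = 1 then largeLang (q.1 - 1) else smallLang (q.1 - 1)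

theorem W_markerHyp {pe : ℕ} {gs gl : ℕ → ℕ} (he : W pe = evens)
    (hs : ∀ m, W (gs m) = smallLang m) (hl : ∀ m, W (gl m) = largeLang m) (q : ℕ × ℕ) :
    W (markerHyp pe gs gl q) = markerLang q := by
  unfold markerHyp markerLang
  by_cases h₁ : q.1 = 0
  · simp [h₁, he]
  · by_cases h₂ : q.2 = 1 <;> simp [h₁, h₂, hs, hl]

theorem markerRun_fst_eq {T : ℕ → Datum} {s t : ℕ} (hst : s ≤ t) (h : (markerRun T s).1 ≠ 0) :
    (markerRun T t).1 = (markerRun T s).1 := by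
  induction t, hst using Nat.le_induction with
  | base => rfl
  | succ t _ ih =>
    rw [← ih] at h ⊢
    rw [markerRun]
    cases T t with
    | none => rfl
    | some a => rw [markerStep_some, if_neg h]; split_ifs <;> rfl

theorem markerRun_const_of_snd_eq_one {T : ℕ → Datum} {s t : ℕ} (hst : s ≤ t)
    (h : (markerRun T s).1 ≠ 0) (h₁ : (markerRun T s).2 = 1) : markerRun T t = markerRun T s := by
  have h₂ := monotone_markerRank T hst
  have h₃ := markerRank_le (markerRun T t)
  have h₄ : markerRank (markerRun T s) = 3 := by simp [markerRank, h, h₁]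
  simp only at h₂
  exact markerRun_eq_of_rank_eq hst (by omega)

theorem markerRun_const_of_fst_eq_zero {T : ℕ → Datum} {s t : ℕ} (hst : s ≤ t)
    (h : (markerRun T t).1 = 0) : markerRun T t = markerRun T s := by
  have h₂ := monotone_markerRank T hst
  have h₄ : markerRank (markerRun T t) = 0 := by simp [markerRank, h]
  simp only at h₂
  exact markerRun_eq_of_rank_eq hst (by omega)

theorem markerHyp_congr {pe : ℕ} {gs gl : ℕ → ℕ} {q q' : ℕ × ℕ} (h : q.1 = q'.1)
    (h₁ : q.2 ≠ 1) (h₂ : q'.2 ≠ 1) : markerHyp pe gs gl q = markerHyp pe gs gl q' := by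
  simp [markerHyp, h, h₁, h₂]

theorem markerSeq_eq_some {pe : ℕ} {gs gl : ℕ → ℕ} {T : ℕ → Datum} {t p : ℕ}
    (h : markerSeq pe gs gl T t = some p) : p = markerHyp pe gs gl (markerRun T t) := by
  cases t with
  | zero => simp [markerSeq] at h
  | succ t => exact (Option.some_injective _ h).symm

theorem markerSeq_eq_of_hyp_eq {pe : ℕ} {gs gl : ℕ → ℕ} {T : ℕ → Datum} {r s p : ℕ} (hrs : r ≤ s)
    (hp : markerSeq pe gs gl T r = some p)
    (h : markerHyp pe gs gl (markerRun T r) = markerHyp pe gs gl (markerRun T s)) :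
    markerSeq pe gs gl T r = markerSeq pe gs gl T s := by
  rcases r with _ | r
  · simp [markerSeq] at hp
  · obtain ⟨s, rfl⟩ : ∃ k, s = k + 1 := ⟨s - 1, by omega⟩
    simp [markerSeq, h]

/-- The conjectured languages run through `evens`, `smallLang m`, `largeLang m` in this order with
`m` fixed by the first marker. They are distinct, and recording the first large even number changes
the state but not the index. -/
theorem sDec_markerSeq {pe : ℕ} {gs gl : ℕ → ℕ} (he : W pe = evens)
    (hs : ∀ m, W (gs m) = smallLang m) (hl : ∀ m, W (gl m) = largeLang m) (T : ℕ → Datum) :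
    SDec (markerSeq pe gs gl T) T := by
  intro r s t hrs hst p q hp hq hW
  refine markerSeq_eq_of_hyp_eq hrs hp ?_
  rw [markerSeq_eq_some hp, markerSeq_eq_some hq, W_markerHyp he hs hl,
    W_markerHyp he hs hl] at hW
  by_cases h₀ : (markerRun T r).1 = 0
  · have h₁ : (markerRun T t).1 = 0 := by
      by_contra h₁
      simp only [markerLang, h₀, h₁, if_true, if_false] at hW
      split_ifs at hW
      · exact evens_ne_largeLang _ hW
      · exact evens_ne_smallLang _ hW
    rw [← markerRun_const_of_fst_eq_zero (hrs.trans hst) h₁,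
      markerRun_const_of_fst_eq_zero hst h₁]
  · by_cases h₁ : (markerRun T r).2 = 1
    · rw [markerRun_const_of_snd_eq_one hrs h₀ h₁]
    · have h₂ := markerRun_fst_eq hrs h₀
      have h₃ := markerRun_fst_eq hst (h₂ ▸ h₀)
      refine markerHyp_congr h₂.symm h₁ fun h₄ => ?_
      have h₅ := markerRun_const_of_snd_eq_one hst (h₂ ▸ h₀) h₄
      simp only [markerLang, h₅, h₂, h₀, h₁, h₄, if_true, if_false] at hW
      exact smallLang_ne_largeLang _ _ hW

/-- Every mind change is forced by data outside the conjecture: a marker refutes `evens`, two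
distinct even numbers above the threshold refute `smallLang m`, and `largeLang m` is never
abandoned. -/
theorem conv_markerSeq {pe : ℕ} {gs gl : ℕ → ℕ} (he : W pe = evens)
    (hs : ∀ m, W (gs m) = smallLang m) (hl : ∀ m, W (gl m) = largeLang m) (T : ℕ → Datum) :
    Conv (markerSeq pe gs gl T) T := by
  intro s t hst p hp hW
  refine markerSeq_eq_of_hyp_eq hst hp ?_
  rw [markerSeq_eq_some hp, W_markerHyp he hs hl] at hW
  have inv := markerInv_run T t
  by_cases h₀ : (markerRun T s).1 = 0
  · by_cases h₁ : (markerRun T t).1 = 0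
    · rw [markerRun_const_of_fst_eq_zero hst h₁]
    · obtain ⟨m, hm⟩ := Nat.exists_eq_succ_of_ne_zero h₁
      have := hW (inv.marker m hm)
      simp only [markerLang, h₀, if_true] at this
      rw [mem_evens] at this
      omega
  · by_cases h₁ : (markerRun T s).2 = 1
    · rw [markerRun_const_of_snd_eq_one hst h₀ h₁]
    · have h₂ := markerRun_fst_eq hst h₀
      refine markerHyp_congr h₂.symm h₁ fun h₄ => ?_
      obtain ⟨m, hm⟩ := Nat.exists_eq_succ_of_ne_zero h₀
      obtain ⟨i, j, hi, hj, hij, hi', hj'⟩ := inv.two m (h₂.trans hm) h₄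
      have hlang : markerLang (markerRun T s) = smallLang m := by
        simp [markerLang, h₁, hm]
      rw [hlang] at hW
      exact hij (eq_of_mem_smallLang hi hj (hW hi') (hW hj'))

theorem exists_bound_initSeg {T : ℕ → Datum} {t : ℕ} :
    ∃ B, ∀ s < t, ∀ a, T s = some a → a < B := by
  induction t with
  | zero => exact ⟨0, by simp⟩
  | succ t ih =>
    obtain ⟨B, hB⟩ := ih
    refine ⟨B + (T t).getD 0 + 1, fun s hs a ha => ?_⟩
    rcases Nat.lt_succ_iff_lt_or_eq.1 hs with h | rfl
    · have := hB s h a ha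
      omega
    · simp [ha]

theorem markerLang_eventually {L : Set ℕ} (hL : L ∈ separatingClass) {T : ℕ → Datum}
    (hT : IsText T L) {t₁ : ℕ} (ht₁ : ∀ t, t₁ ≤ t → markerRun T t = markerRun T t₁) :
    markerLang (markerRun T t₁) = L := by
  have inv := markerInv_run T t₁
  have hsub := listContent_initSeg_subset T t₁
  rw [hT] at hsub
  have hmark : ∀ m, 2 * m + 1 ∈ L → (markerRun T t₁).1 ≠ 0 := by
    intro m hm h₀
    rw [← hT] at hm
    obtain ⟨t, ht⟩ := hm
    have h₁ := ht₁ (t₁ + t + 1) (by omega)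
    have := (markerInv_run T (t₁ + t + 1)).even (h₁ ▸ h₀)
      (mem_initSeg.2 ⟨t, by omega, ht⟩ : 2 * m + 1 ∈ listContent _)
    rw [mem_evens] at this
    omega
  rcases hL with (rfl | ⟨m, rfl⟩) | ⟨m, rfl⟩
  · have h₀ : (markerRun T t₁).1 = 0 := by
      by_contra h₀
      obtain ⟨m, hm⟩ := Nat.exists_eq_succ_of_ne_zero h₀
      have := hsub (inv.marker m hm)
      rw [mem_evens] at this
      omega
    simp [markerLang, h₀]
  · have h₀ := hmark m (Or.inr (Or.inl rfl))
    obtain ⟨m', hm⟩ := Nat.exists_eq_succ_of_ne_zero h₀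
    obtain rfl : m' = m := by
      have := hsub (inv.marker m' hm)
      rw [mem_smallLang] at this
      rcases this with h | h | ⟨j, -, h⟩ <;> omega
    have h₁ : (markerRun T t₁).2 ≠ 1 := by
      intro h₁
      obtain ⟨i, j, hi, hj, hij, hi', hj'⟩ := inv.two m' hm h₁
      exact hij (eq_of_mem_smallLang hi hj (hsub hi') (hsub hj'))
    simp [markerLang, h₁, hm]
  · have h₀ := hmark m (Or.inr rfl)
    obtain ⟨m', hm⟩ := Nat.exists_eq_succ_of_ne_zero h₀
    obtain rfl : m' = m := by
      have := hsub (inv.marker m' hm)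
      rw [mem_largeLang] at this
      omega
    have h₁ : (markerRun T t₁).2 = 1 := by
      by_contra h₁
      obtain ⟨B, hB⟩ := exists_bound_initSeg (T := T) (t := t₁)
      -- The three summands make `2 * j` appear only from time `t₁` on, put `j` above the threshold,
      -- and make `j` differ from any number recorded in the state.
      set j := B + m'.unpair.1 + (markerRun T t₁).2 with hj
      have hmem : 2 * j ∈ content T := by rw [hT, mem_largeLang]; omega
      obtain ⟨t, ht⟩ := hmem
      have htt : t₁ ≤ t := by
        by_contra hlt
        have := hB t (by omega) _ ht
        omega
      have hstep : markerStep (markerRun T t₁) (some (2 * j)) = markerRun T t₁ := by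
        have := ht₁ (t + 1) (by omega)
        rwa [markerRun, ht₁ t htt, ht] at this
      rw [markerStep_some, if_neg h₀, if_pos ⟨by omega, by rw [hm]; simp; omega⟩] at hstep
      split_ifs at hstep with h₂ h₃
      · have := congrArg Prod.snd hstep
        simp only at this
        omega
      · omega
      · exact h₁ (congrArg Prod.snd hstep).symm
    simp [markerLang, h₁, hm]

/-- The state transition function of the learner, on encoded states. -/
def markerState : ℕ → Datum →. ℕ := fun q x =>
  Part.some (Encodable.encode (markerStep (Denumerable.ofNat (ℕ × ℕ) q) x))

/-- The hypothesis generating function of the learner, on encoded states. -/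
def markerOut (pe : ℕ) (gs gl : ℕ → ℕ) : ℕ → Datum →. Hyp := fun q x =>
  Part.some (some (markerHyp pe gs gl (markerStep (Denumerable.ofNat (ℕ × ℕ) q) x)))

theorem bmsState_markerState (T : ℕ → Datum) (t : ℕ) :
    bmsState markerState (initSeg T t) = Part.some (Encodable.encode (markerRun T t)) := by
  induction t with
  | zero => rfl
  | succ t ih =>
    rw [initSeg_succ, bmsState_concat, ih, Part.bind_some, markerState, Denumerable.ofNat_encode,
      markerRun]

theorem bmsLearner_markerOut (pe : ℕ) (gs gl : ℕ → ℕ) (T : ℕ → Datum) (t : ℕ) :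
    bmsLearner (markerOut pe gs gl) markerState (initSeg T t) =
      Part.some (markerSeq pe gs gl T t) := by
  cases t with
  | zero => rfl
  | succ t =>
    rw [initSeg_succ, bmsLearner_concat, bmsState_markerState, Part.bind_some, markerOut,
      Denumerable.ofNat_encode, markerSeq, markerRun]

theorem separatingClass_mem_txtBMSStarEx {δ : (ℕ → Hyp) → (ℕ → Datum) → Prop}
    (hδ : ∀ e T, Conv e T → SDec e T → δ e T) : separatingClass ∈ TxtBMSStarEx δ := by
  obtain ⟨pe, he⟩ := exists_index_evens
  obtain ⟨gs, hgs, hs⟩ := exists_index_smallLang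
  obtain ⟨gl, hgl, hl⟩ := exists_index_largeLang
  have hstep : Computable fun p : ℕ × Datum =>
      markerStep (Denumerable.ofNat (ℕ × ℕ) p.1) p.2 :=
    primrec_markerStep.to_comp.comp ((Computable.ofNat _).comp .fst) .snd
  refine ⟨fun _ => isLanguage_of_mem_separatingClass, markerOut pe gs gl, markerState,
    Computable.partrec (Computable.option_some.comp ((computable_markerHyp pe hgs hgl).comp hstep)),
    Computable.partrec (Computable.encode.comp hstep), fun q x => Iff.rfl, ?_⟩
  intro L hL T hT
  obtain ⟨t₁, ht₁⟩ := exists_markerRun_eventually_const T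
  -- Convergence is claimed from `t₁ + 1`, because `t₁` may be `0`, where the hypothesis is `?`.
  refine ⟨?_, markerSeq pe gs gl T, fun t => ?_,
    hδ _ _ (conv_markerSeq he hs hl T) (sDec_markerSeq he hs hl T), t₁ + 1, ?_, ?_⟩
  · refine ((Set.finite_Iic t₁).image fun t => Encodable.encode (markerRun T t)).subset ?_
    rintro q ⟨t, hq⟩
    rw [bmsState_markerState, Part.mem_some_iff] at hq
    subst hq
    rcases le_total t t₁ with h | h
    · exact ⟨t, h, rfl⟩
    · exact ⟨t₁, le_refl t₁, by simp only [ht₁ t h]⟩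
  · rw [bmsLearner_markerOut]
    exact Part.mem_some _
  · refine ⟨_, rfl, ?_⟩
    rw [W_markerHyp he hs hl, ht₁ _ (Nat.le_succ _), hT]
    exact markerLang_eventually hL hT ht₁
  · rintro (_ | t) ht -
    · omega
    · simp only [markerSeq, ht₁ (t + 1) (by omega), ht₁ (t₁ + 1) (by omega)]

theorem SDec.snu {e : ℕ → Hyp} {T : ℕ → Datum} (h : SDec e T) : SNU e T := by
  rintro r s t hrs hst ⟨p, hp, hWp⟩ ⟨q, hq, hWq⟩
  exact h r s t hrs hst p q hp hq (hWp.trans hWq.symm)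

theorem Conv.snu {e : ℕ → Hyp} {T : ℕ → Datum} (h : Conv e T) : SNU e T := by
  rintro r s t hrs - ⟨p, hp, hW⟩ -
  exact h r s hrs p hp (hW ▸ listContent_initSeg_subset T s)

/-! ### No strongly non-U-shaped iterative learner for the separating class -/

/-- Partial computable selection: a partial computable function that finds a value in the range of
a section of `f`, if there is one. -/
theorem exists_partrec_selection {α : Type*} [Primcodable α] {f : α → ℕ →. ℕ} (hf : Partrec₂ f) :
    ∃ F : α →. ℕ, Partrec F ∧ (∀ a, ∀ y ∈ F a, ∃ i, y ∈ f a i) ∧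
      ∀ a i, (f a i).Dom → (F a).Dom := by
  obtain ⟨c, hc⟩ := Code.exists_code.1 hf
  have hc' : ∀ a i, Code.eval c (Encodable.encode (a, i)) = f a i := by
    intro a i
    simp [hc, Part.map_id']
  -- Dovetailing: `s` codes a step bound together with an argument `i`.
  refine ⟨fun a => Nat.rfindOpt fun s => Code.evaln s.unpair.1 c (Encodable.encode (a, s.unpair.2)),
    Partrec.rfindOpt ?_, ?_, ?_⟩
  · have u : Computable fun p : α × ℕ => p.2.unpair := Computable.unpair.comp .snd
    exact (Code.primrec_evaln.to_comp.comp
      (((Computable.fst.comp u).pair (.const c)).pair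
        (Computable.encode.comp (Computable.fst.pair (Computable.snd.comp u))))).to₂
  · intro a y hy
    obtain ⟨s, hs⟩ := Nat.rfindOpt_spec hy
    exact ⟨s.unpair.2, hc' a _ ▸ Code.evaln_sound hs⟩
  · intro a i hd
    obtain ⟨y, hy⟩ := Part.dom_iff_mem.1 hd
    rw [← hc'] at hy
    obtain ⟨k, hk⟩ := Code.evaln_complete.1 hy
    exact Nat.rfindOpt_dom.2 ⟨Nat.pair k i, y, by simpa using hk⟩

/-- The hypothesis of an iterative learner after `k` pause symbols, started at `u`. -/
def pauseRun (h : Hyp → Datum →. Hyp) (u : Part Hyp) (k : ℕ) : Part Hyp :=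
  Nat.rec u (fun _ v => v.bind fun v' => h v' none) k

theorem pauseRun_succ (h : Hyp → Datum →. Hyp) (u : Part Hyp) (k : ℕ) :
    pauseRun h u (k + 1) = (pauseRun h u k).bind fun v => h v none := rfl

theorem itLearner_pause {h : Hyp → Datum →. Hyp} {σ : List Datum} {u : Part Hyp}
    (hu : itLearner h σ = u) (k : ℕ) :
    itLearner h (σ ++ List.replicate k none) = pauseRun h u k := by
  induction k with
  | zero => simpa [pauseRun] using hu
  | succ k ih => rw [List.replicate_succ', ← List.append_assoc, itLearner_concat, ih, pauseRun_succ]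

/-- For a hypothesis `a` there is a program `c` that knows the marker `2 * ⟨n, c⟩ + 1` and searches
for a number `2 * j`, `n ≤ j`, that makes the learner change its mind after the marker and
sufficiently many pause symbols. -/
theorem exists_program {h : Hyp → Datum →. Hyp} (hh : Partrec₂ h) (a : Hyp) (n : ℕ) :
    ∃ c : ℕ, ∃ v : ℕ → Part Hyp,
      (∀ k, v k = pauseRun h (h a (some (2 * Nat.pair n c + 1))) k) ∧
      (∀ j ∈ phi c 0, n ≤ j ∧ ∃ k, ∃ w ∈ v k, w ∈ h w none ∧
        ∃ w' ∈ h w (some (2 * j)), w' ≠ w) ∧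
      ∀ j, n ≤ j → ∀ k, ∀ w ∈ v k, w ∈ h w none →
        ∀ w' ∈ h w (some (2 * j)), w' ≠ w → (phi c 0).Dom := by
  let u : Code → Part Hyp := fun c => h a (some (2 * Nat.pair n (Encodable.encode c) + 1))
  -- Here `i` codes `(j - n, k)`. The test requires `w` to be a fixed point of the pause, which
  -- makes the choice of `k` irrelevant.
  let f : Code → ℕ →. ℕ := fun c i => (pauseRun h (u c) i.unpair.2).bind fun w =>
    (h w none).bind fun w₁ => (h w (some (2 * (n + i.unpair.1)))).bind fun w₂ =>
      ((if w₁ = w ∧ w₂ ≠ w then some (n + i.unpair.1) else none : Option ℕ) : Part ℕ)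
  have hu : Partrec u := by
    refine hh.comp (Computable.const a) (Computable.option_some.comp ?_)
    exact primrec_marker.to_comp.comp
      (Primrec₂.natPair.to_comp.comp (Computable.const n) Computable.encode)
  have hrun : Partrec fun p : Code × ℕ => pauseRun h (u p.1) p.2.unpair.2 :=
    Partrec.nat_rec (Computable.snd.comp (Computable.unpair.comp .snd)) (hu.comp .fst)
      (hh.comp (Computable.snd.comp .snd) (Computable.const none)).to₂
  have hj : Primrec fun p : Code × ℕ => n + p.2.unpair.1 :=
    Primrec.nat_add.comp (.const n) (Primrec.fst.comp (Primrec.unpair.comp .snd))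
  have hf : Partrec₂ f := by
    refine hrun.bind ((hh.comp Computable.snd (Computable.const none)).bind ?_)
    have hj' := hj.comp (Primrec.fst.comp
      (Primrec.fst (α := (Code × ℕ) × Hyp) (β := Hyp)))
    refine (hh.comp (Computable.snd.comp .fst) (Computable.option_some.comp
      (Primrec.nat_mul.comp (.const 2) hj').to_comp)).bind ?_
    have w : Primrec fun p : (((Code × ℕ) × Hyp) × Hyp) × Hyp => p.1.1.2 :=
      Primrec.snd.comp (Primrec.fst.comp .fst)
    refine (Computable.ofOption (Primrec.to_comp (Primrec.ite
      ((Primrec.eq.comp (Primrec.snd.comp .fst) w).and (Primrec.eq.comp .snd w).not)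
      (Primrec.option_some.comp (hj'.comp .fst)) (.const none)))).to₂
  obtain ⟨F, hF, h₁, h₂⟩ := exists_partrec_selection hf
  -- The recursion theorem lets `c` run the search for the marker that contains its own code.
  obtain ⟨c, hc⟩ := Code.fixed_point₂ (f := fun c _ => F c) (hF.comp Computable.fst).to₂
  have hphi : phi (Encodable.encode c) 0 = F c := by simp [phi, hc]
  refine ⟨Encodable.encode c, pauseRun h (u c), fun k => rfl, ?_, ?_⟩
  · intro j hj
    rw [hphi] at hj
    obtain ⟨i, hi⟩ := h₁ c j hj
    simp only [f, Part.mem_bind_iff] at hi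
    obtain ⟨w, hw, w₁, hw₁, w₂, hw₂, hi⟩ := hi
    split_ifs at hi with hcond
    · obtain rfl : j = n + i.unpair.1 := by simpa using hi
      exact ⟨by omega, _, w, hw, hcond.1 ▸ hw₁, w₂, hw₂, hcond.2⟩
    · simp at hi
  · intro j hj k w hw hw₁ w' hw' hne
    rw [hphi]
    refine h₂ c (Nat.pair (j - n) k) (Part.dom_iff_mem.2 ⟨j, ?_⟩)
    have hjn : n + (j - n) = j := by omega
    simp only [f, Part.mem_bind_iff, Nat.unpair_pair, hjn]
    exact ⟨w, hw, w, hw₁, w', hw', by simp [hne]⟩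

/-- Two pause-fixed hypotheses on one run are therefore equal, by comparison at a common later time.
-/
theorem pauseRun_fixed {h : Hyp → Datum →. Hyp} {u : Part Hyp} {k : ℕ} {w : Hyp}
    (hw : w ∈ pauseRun h u k) (hfix : w ∈ h w none) {l : ℕ} (hkl : k ≤ l) :
    w ∈ pauseRun h u l := by
  induction l, hkl using Nat.le_induction with
  | base => exact hw
  | succ l _ ih =>
    rw [pauseRun_succ]
    exact Part.mem_bind_iff.2 ⟨w, ih, hfix⟩

theorem initSeg_const_none (k : ℕ) : initSeg (fun _ => none) k = List.replicate k none := by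
  simp [initSeg, List.map_const']

theorem separatingClass_not_learnable {h : Hyp → Datum →. Hyp} (hh : Partrec₂ h) :
    ¬ ∀ L ∈ separatingClass, ItLearnsSNU h L := by
  intro hall
  have hX : ItLearnsSNU h evens := hall _ (Or.inl (Or.inl rfl))
  let T₀ : ℕ → Datum := fun t => some (2 * t)
  have hT₀ : IsText T₀ evens := by
    ext x
    rw [mem_evens]
    constructor
    · rintro ⟨t, ht⟩
      have := Option.some_injective _ ht
      omega
    · exact fun hx => ⟨x / 2, congrArg some (by omega)⟩
  obtain ⟨n, -, a, ha, hWa⟩ := hX.exists_correct hT₀ 0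
  set σ := initSeg T₀ n with hσ
  have hσc : listContent σ = {x | x % 2 = 0 ∧ x / 2 < n} := by
    ext x
    change some x ∈ initSeg T₀ n ↔ _
    rw [mem_initSeg]
    constructor
    · rintro ⟨s, hs, h⟩
      have := Option.some_injective _ h
      refine ⟨?_, ?_⟩ <;> omega
    · rintro ⟨h₁, h₂⟩
      exact ⟨x / 2, h₂, congrArg some (by omega)⟩
  have hσe : listContent σ ⊆ evens := by rw [hσc]; exact fun x hx => hx.1
  obtain ⟨c, v, hv, hc₁, hc₂⟩ := exists_program hh (some a) n
  set m := Nat.pair n c with hm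
  have hm₁ : m.unpair.1 = n := by simp [hm]
  have hm₂ : m.unpair.2 = c := by simp [hm]
  have hS : ItLearnsSNU h (smallLang m) := hall _ (Or.inl (Or.inr ⟨m, rfl⟩))
  have hB : ItLearnsSNU h (largeLang m) := hall _ (Or.inr ⟨m, rfl⟩)
  -- reading even numbers between `σ` and the marker has no effect
  have hrun : ∀ τ, listContent τ ⊆ evens → ∀ k,
      itLearner h (σ ++ τ ++ [some (2 * m + 1)] ++ List.replicate k none) = v k := by
    intro τ hτ k
    rw [hv]
    refine itLearner_pause ?_ k
    rw [itLearner_concat, Part.eq_some_iff.2 (hX.locked hσe ha hWa hτ), Part.bind_some]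
  -- the hypothesis becomes correct for the small language
  obtain ⟨τ, hτe, hτS⟩ : ∃ τ : List Datum, listContent τ ⊆ evens ∧
      listContent σ ∪ listContent τ ∪ {2 * m + 1} = smallLang m := by
    by_cases hd : (phi c 0).Dom
    · obtain ⟨j, hj⟩ := Part.dom_iff_mem.1 hd
      refine ⟨[some (2 * j)], fun x hx => ?_, ?_⟩
      · have : x = 2 * j := by simpa [listContent] using hx
        rw [mem_evens]; omega
      · ext x
        rw [mem_smallLang, hm₁, hm₂, hσc]
        have : (∃ i ∈ phi c 0, x = 2 * i) ↔ x = 2 * j :=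
          ⟨fun ⟨i, hi, hx⟩ => Part.mem_unique hi hj ▸ hx, fun hx => ⟨j, hj, hx⟩⟩
        rw [this]
        simp [listContent]
        tauto
    · refine ⟨[], fun x hx => by simp [listContent] at hx, ?_⟩
      ext x
      rw [mem_smallLang, hm₁, hm₂, hσc]
      have : ¬ ∃ i ∈ phi c 0, x = 2 * i := fun ⟨i, hi, _⟩ => hd (Part.dom_iff_mem.2 ⟨i, hi⟩)
      simp only [this, or_false]
      simp [listContent, or_comm]
  set ρ := σ ++ τ ++ [some (2 * m + 1)] with hρ
  have hmark : listContent [some (2 * m + 1)] = {2 * m + 1} := by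
    ext x; simp [listContent]
  have hρc : listContent ρ = smallLang m := by
    rw [hρ, listContent_append, listContent_append, hmark, hτS]
  have hpause : ∀ k, listContent (List.replicate k none) ⊆ smallLang m := by
    intro k x hx
    have : some x ∈ List.replicate k (none : Datum) := hx
    simp [List.mem_replicate] at this
  have hTρ : IsText (prepend ρ fun _ => none) (smallLang m) := by
    rw [IsText, content_prepend, hρc]
    simp [content]
  obtain ⟨t, ht, p, hp, hWp⟩ := hS.exists_correct hTρ ρ.length
  obtain ⟨K, rfl⟩ := Nat.exists_eq_add_of_le ht
  rw [initSeg_prepend, initSeg_const_none] at hp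
  have hρK : listContent (ρ ++ List.replicate K none) ⊆ smallLang m := by
    rw [listContent_append, hρc]
    exact Set.union_subset subset_rfl (hpause K)
  have hpv : some p ∈ v K := hrun τ hτe K ▸ hp
  have hstay : ∀ x, (∀ y, x = some y → y ∈ smallLang m) → some p ∈ h (some p) x := by
    intro x hx
    have := hS.locked hρK hp hWp (τ := [x]) (fun y hy => hx y (by
      simpa [listContent, eq_comm] using hy))
    rwa [itLearner_concat, Part.eq_some_iff.2 hp, Part.bind_some] at this
  have hfix : some p ∈ h (some p) none := hstay none (by simp)
  by_cases hd : (phi c 0).Dom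
  -- The search succeeded: the hypothesis it found is `p`, which is locked on `smallLang m`,
  -- although `2 * j` from that language changes it.
  · obtain ⟨j, hj⟩ := Part.dom_iff_mem.1 hd
    obtain ⟨-, k, w, hw, hwf, w', hw', hne⟩ := hc₁ j hj
    have hwp : w = some p := by
      rw [hv] at hw hpv
      exact Part.mem_unique (pauseRun_fixed hw hwf (Nat.le_add_right k K))
        (pauseRun_fixed hpv hfix (Nat.le_add_left K k))
    subst hwp
    refine hne (Part.mem_unique hw' (hstay _ ?_))
    rintro y hy
    cases hy
    exact Or.inr (Or.inr ⟨j, hm₂.symm ▸ hj, rfl⟩)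
  · -- no even number changes the hypothesis any more
    set ρ' := σ ++ [some (2 * m + 1)] ++ List.replicate K none with hρ'
    have hp' : some p ∈ itLearner h ρ' := by
      have := hrun [] (by simp [listContent]) K
      rw [List.append_nil] at this
      rw [hρ', this]
      exact hpv
    let T₁ : ℕ → Datum := fun t => some (2 * (n + t))
    have hT₁ : IsText (prepend ρ' T₁) (largeLang m) := by
      rw [IsText, content_prepend, hρ', listContent_append, listContent_append, hmark, hσc]
      ext x
      rw [mem_largeLang]
      constructor
      · rintro (((h | h) | h) | ⟨t, h⟩)
        · exact Or.inl h.1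
        · exact Or.inr h
        · have : some x ∈ List.replicate K (none : Datum) := h
          simp [List.mem_replicate] at this
        · have := Option.some_injective _ h
          omega
      · rintro (h | h)
        · by_cases hx : x / 2 < n
          · exact Or.inl (Or.inl (Or.inl ⟨h, hx⟩))
          · exact Or.inr ⟨x / 2 - n, congrArg some (by omega)⟩
        · exact Or.inl (Or.inl (Or.inr h))
    -- `he` makes the learner defined on each `2 * (n + k)`; a value other than `p` there would make
    -- `c` halt.
    obtain ⟨e, he, -, -⟩ := hB _ hT₁
    have hconst : ∀ k, some p ∈ itLearner h (initSeg (prepend ρ' T₁) (ρ'.length + k)) := by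
      intro k
      induction k with
      | zero => rw [add_zero, initSeg_prepend_length]; exact hp'
      | succ k ih =>
        have hk := he (ρ'.length + (k + 1))
        rw [initSeg_prepend] at ih hk ⊢
        rw [initSeg_succ, ← List.append_assoc, itLearner_concat, Part.eq_some_iff.2 ih,
          Part.bind_some] at hk ⊢
        by_contra hne
        exact hd (hc₂ (n + k) (Nat.le_add_right n k) K _ hpv hfix _ hk fun h => hne (h ▸ hk))
    obtain ⟨t, ht, q, hq, hWq⟩ := hB.exists_correct hT₁ ρ'.length
    obtain ⟨k, rfl⟩ := Nat.exists_eq_add_of_le ht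
    have : p = q := Option.some_injective _ (Part.mem_unique (hconst k) hq)
    exact smallLang_ne_largeLang m m (hWp.symm.trans (this ▸ hWq))

/-- The separation works for any δ between the conjunction of Conv and SDec, which the positive part
delivers, and SNU, which the negative part refutes. -/
theorem itTxtEx_ssubset {δ : (ℕ → Hyp) → (ℕ → Datum) → Prop}
    (h₁ : ∀ e T, Conv e T → SDec e T → δ e T) (h₂ : ∀ e T, δ e T → SNU e T) :
    ItTxtEx δ ⊂ TxtBMSStarEx δ := by
  refine (Set.ssubset_iff_of_subset (itTxtEx_subset δ)).2
    ⟨separatingClass, separatingClass_mem_txtBMSStarEx h₁, ?_⟩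
  rintro ⟨-, h, hh, hL⟩
  refine separatingClass_not_learnable hh fun L hLC T hT => ?_
  obtain ⟨e, he, hδ, hex⟩ := hL L hLC T hT
  exact ⟨e, he, h₂ e T hδ, hex⟩

end InductiveInference

theorem mainTheorem7 :
    InductiveInference.ItTxtEx InductiveInference.SNU ⊂
        InductiveInference.TxtBMSStarEx InductiveInference.SNU ∧
      InductiveInference.ItTxtEx InductiveInference.SDec ⊂
        InductiveInference.TxtBMSStarEx InductiveInference.SDec ∧
      InductiveInference.ItTxtEx InductiveInference.Conv ⊂
        InductiveInference.TxtBMSStarEx InductiveInference.Conv :=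
  ⟨InductiveInference.itTxtEx_ssubset (fun _ _ _ h => h.snu) fun _ _ h => h,
    InductiveInference.itTxtEx_ssubset (fun _ _ _ h => h) fun _ _ h => h.snu,
    InductiveInference.itTxtEx_ssubset (fun _ _ h _ => h) fun _ _ h => h.snu⟩
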